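/- \textbf{Theorem} (Memorization phenomenon under the optimal velocity field). \label{thm:memorization} Let $d\ge 0$ and $N\ge 1$ be integers, and let $y^1,\dots,y^N\in\mathbb{R}^d$ (not necessarily distinct). For $t\in[0,1)$ and $x\in\mathbb{R}^d$ let \[ v_t^*(x)=\sum_{i=1}^{N}\frac{y^i-x}{1-t}\cdot\frac{\exp\big(-\|(x-ty^i)/(1-t)\|_2^2/2\big)}{\sum_{j=1}^{N}\exp\big(-\|(x-ty^j)/(1-t)\|_2^2/2\big)}, \] which is the optimal velocity field of Flow Matching along optimal transport paths with standard Gaussian prior and target $\frac1N\sum_{i=1}^N\delta_{y^i}$. Consider the flow ODE \[ \frac{\mathrm{d}\phi_t(x)}{\mathrm{d}t}=v_t^*(\phi_t(x)),\qquad \phi_0(x)=x,\qquad t\in[0,1), \] where $\phi_1(x)=\lim_{t\uparrow 1}\phi_t(x)$, that is, $t\mapsto\phi_t(x)$ is required to be continuous on $[0,1]$. Then for every $x\in\mathbb{R}^d$ such a path exists and is unique, and the set of endpoints $\{\phi_1(x)\colon x\in\mathbb{R}^d\}$ equals $\{y^1,\dots,y^N\}$ up to a finite set, in the following sense: it contains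 every $y^i$, and $\{\phi_1(x)\colon x\in\mathbb{R}^d\}\setminus\{y^1,\dots,y^N\}$ is finite. -/

import Mathlib

/-- The softmax weight of the data point `y i` at time `t` and position `x`:
`exp (-‖(x - t y i) / (1 - t)‖² / 2) / ∑ j, exp (-‖(x - t y j) / (1 - t)‖² / 2)`. -/
noncomputable def otWeight {d N : ℕ} (y : Fin N → EuclideanSpace ℝ (Fin d))
    (t : ℝ) (x : EuclideanSpace ℝ (Fin d)) (i : Fin N) : ℝ :=
  Real.exp (-‖(1 - t)⁻¹ • (x - t • y i)‖ ^ 2 / 2) /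
    ∑ j, Real.exp (-‖(1 - t)⁻¹ • (x - t • y j)‖ ^ 2 / 2)

/-- The optimal velocity field for optimal transport paths with standard Gaussian prior and
target `(1/N) ∑ i, δ_{y i}`: the weighted sum of the directions `(y i - x) / (1 - t)`.
It is meaningful for `t < 1` only. -/
noncomputable def optimalVelocity {d N : ℕ} (y : Fin N → EuclideanSpace ℝ (Fin d))
    (t : ℝ) (x : EuclideanSpace ℝ (Fin d)) : EuclideanSpace ℝ (Fin d) :=
  ∑ i, otWeight y t x i • ((1 - t)⁻¹ • (y i - x))

/-- `φ` is a flow of the optimal velocity field on `[0, 1]`: every path `t ↦ φ t x` starts at `x`,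
solves the differential equation at every time `t ∈ [0, 1)` (one-sidedly at `t = 0`), and is
continuous on `[0, 1]`. The velocity field is singular at `t = 1`, so that continuity is what
defines the endpoint: `φ 1 x` is the limit of `φ t x` as `t` increases to `1`. -/
structure IsOptimalFlow {d N : ℕ} (y : Fin N → EuclideanSpace ℝ (Fin d))
    (φ : ℝ → EuclideanSpace ℝ (Fin d) → EuclideanSpace ℝ (Fin d)) : Prop where
  initial : ∀ x, φ 0 x = x
  continuousOn : ∀ x, ContinuousOn (fun t => φ t x) (Set.Icc 0 1)
  hasDeriv : ∀ x, ∀ t ∈ Set.Ico (0 : ℝ) 1,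
    HasDerivWithinAt (fun s => φ s x) (optimalVelocity y t (φ t x)) (Set.Icc 0 1) t

/-!
The substitution `s = t / (1 - t)`, `z = x / (1 - t)` turns the singular equation on `[0, 1)` into
`z' = m(s, z)` on `[0, ∞)`, where `m = gaussMean y` is the average of the data points with weights
proportional to `exp (-‖z - s y i‖² / 2)`. This field is smooth on all of `ℝ × ℝ^d` and bounded, so
solutions exist and are unique for all real times, forwards and backwards
(`exists_forall_hasDerivAt_of_bounded`, `ODE_solution_unique_of_contDiff_right`), and the endpoint
of a path is the limit of `u = z / s` as `s → ∞` (`tendsto_flow_of_tendsto`).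

In logarithmic time `u` satisfies `u' = m - u`, a time-dependent gradient flow for a soft version of
half the squared distance to the data. With a correction that absorbs the explicit time dependence,
the energy decreases at rate at least `‖u'‖²` (`exists_hasDerivAt_flowEnergy_le`); the point is that
the entropy of the weights is bounded. A point `p` is critical if it lies in the convex hull of its
nearest data points. Near a noncritical point the weights concentrate on the nearest data points,
so the speed `‖m - u‖` stays away from zero (`exists_eventually_le_norm_gaussMean_sub`), and the
lower bound of the energy forbids returning there at arbitrarily late times
(`not_mapClusterPt_of_energy`). Hence every cluster point of `u` is critical. A
critical point is the circumcentre of its nearest data points, so there are finitely many, and a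
bounded continuous curve with finitely many cluster points converges
(`exists_tendsto_of_finite_mapClusterPt`). All endpoints are therefore among finitely many points.

A data point `a` is attained because a small cone `‖z - s a‖ ≤ r s` traps solutions at late times:
starting at its axis and solving backwards to `s = 0` gives the initial position
(`exists_forall_hasDerivAt_tendsto`).
-/

open Set Filter Topology Metric
open scoped NNReal

/-! ### Bounded differential equations with continuously differentiable right-hand side -/

theorem ContDiff.exists_lipschitzOnWith_uncurry {E : Type*} [NormedAddCommGroup E]
    [NormedSpace ℝ E] [FiniteDimensional ℝ E] {v : ℝ → E → E}
    (hv : ContDiff ℝ 1 (Function.uncurry v)) (a b : ℝ) (x : E) (R : ℝ) :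
    ∃ K : ℝ≥0, ∀ t ∈ Icc a b, LipschitzOnWith K (v t) (closedBall x R) := by
  have := FiniteDimensional.proper_real E
  obtain ⟨K, hK⟩ := hv.contDiffOn.exists_lipschitzOnWith (s := Icc a b ×ˢ closedBall x R)
    one_ne_zero ((convex_Icc a b).prod (convex_closedBall x R))
    (isCompact_Icc.prod (isCompact_closedBall x R))
  refine ⟨K, fun t ht => LipschitzOnWith.of_dist_le_mul fun p hp q hq => ?_⟩
  have h := hK.dist_le_mul (t, p) ⟨ht, hp⟩ (t, q) ⟨ht, hq⟩
  simpa [Prod.dist_eq] using h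

theorem ContinuousOn.exists_closedBall_zero {E : Type*} [NormedAddCommGroup E] {f : ℝ → E}
    {a b : ℝ} (hf : ContinuousOn f (Icc a b)) : ∃ R : ℝ, ∀ t ∈ Icc a b, f t ∈ closedBall 0 R := by
  obtain ⟨R, hR⟩ := isCompact_Icc.exists_bound_of_continuousOn hf
  exact ⟨R, fun t ht => by simpa using hR t ht⟩

theorem ODE_solution_unique_of_contDiff_right {E : Type*} [NormedAddCommGroup E]
    [NormedSpace ℝ E] [FiniteDimensional ℝ E] {v : ℝ → E → E}
    (hv : ContDiff ℝ 1 (Function.uncurry v)) {a b : ℝ} {f g : ℝ → E}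
    (hf : ContinuousOn f (Icc a b))
    (hf' : ∀ t ∈ Ico a b, HasDerivWithinAt f (v t (f t)) (Ici t) t)
    (hg : ContinuousOn g (Icc a b))
    (hg' : ∀ t ∈ Ico a b, HasDerivWithinAt g (v t (g t)) (Ici t) t)
    (h : f a = g a) : EqOn f g (Icc a b) := by
  obtain ⟨R, hR⟩ := hf.exists_closedBall_zero
  obtain ⟨S, hS⟩ := hg.exists_closedBall_zero
  obtain ⟨K, hK⟩ := hv.exists_lipschitzOnWith_uncurry a b 0 (max R S)
  have hRS := closedBall_subset_closedBall (x := (0 : E)) (le_max_left R S)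
  have hSR := closedBall_subset_closedBall (x := (0 : E)) (le_max_right R S)
  exact ODE_solution_unique_of_mem_Icc_right (s := fun _ => closedBall 0 (max R S))
    (fun t ht => hK t (Ico_subset_Icc_self ht)) hf hf'
    (fun t ht => hRS (hR t (Ico_subset_Icc_self ht))) hg hg'
    (fun t ht => hSR (hS t (Ico_subset_Icc_self ht))) h

theorem ODE_solution_unique_of_contDiff {E : Type*} [NormedAddCommGroup E]
    [NormedSpace ℝ E] [FiniteDimensional ℝ E] {v : ℝ → E → E}
    (hv : ContDiff ℝ 1 (Function.uncurry v)) {a b t₀ : ℝ} (ht₀ : t₀ ∈ Ioo a b) {f g : ℝ → E}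
    (hf : ContinuousOn f (Icc a b)) (hf' : ∀ t ∈ Ioo a b, HasDerivAt f (v t (f t)) t)
    (hg : ContinuousOn g (Icc a b)) (hg' : ∀ t ∈ Ioo a b, HasDerivAt g (v t (g t)) t)
    (h : f t₀ = g t₀) : EqOn f g (Icc a b) := by
  obtain ⟨R, hR⟩ := hf.exists_closedBall_zero
  obtain ⟨S, hS⟩ := hg.exists_closedBall_zero
  obtain ⟨K, hK⟩ := hv.exists_lipschitzOnWith_uncurry a b 0 (max R S)
  have hRS := closedBall_subset_closedBall (x := (0 : E)) (le_max_left R S)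
  have hSR := closedBall_subset_closedBall (x := (0 : E)) (le_max_right R S)
  exact ODE_solution_unique_of_mem_Icc (s := fun _ => closedBall 0 (max R S))
    (fun t ht => hK t (Ioo_subset_Icc_self ht)) ht₀ hf hf'
    (fun t ht => hRS (hR t (Ioo_subset_Icc_self ht))) hg hg'
    (fun t ht => hSR (hS t (Ioo_subset_Icc_self ht))) h

/-- A bounded `C¹` field has a solution on any compact time interval: solutions starting at `x₀`
stay in the ball of radius `C * T`, on which the Picard-Lindelöf theorem applies at once. -/
theorem exists_hasDerivWithinAt_Icc_of_bounded {E : Type*} [NormedAddCommGroup E]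
    [NormedSpace ℝ E] [FiniteDimensional ℝ E] {v : ℝ → E → E}
    (hv : ContDiff ℝ 1 (Function.uncurry v)) {C : ℝ≥0} (hC : ∀ t x, ‖v t x‖ ≤ C) (t₀ : ℝ) (x₀ : E)
    (T : ℝ≥0) :
    ∃ f : ℝ → E, f t₀ = x₀ ∧ ∀ t ∈ Icc (t₀ - T) (t₀ + T),
      HasDerivWithinAt f (v t (f t)) (Icc (t₀ - T) (t₀ + T)) t := by
  have := FiniteDimensional.complete ℝ E
  obtain ⟨K, hK⟩ := hv.exists_lipschitzOnWith_uncurry (t₀ - T) (t₀ + T) x₀ (C * T : ℝ≥0)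
  have hT : (0 : ℝ) ≤ T := T.2
  refine IsPicardLindelof.exists_eq_forall_mem_Icc_hasDerivWithinAt₀
    (t₀ := ⟨t₀, by simp⟩) (a := C * T) (L := C) (K := K)
    ⟨hK, fun x _ => ?_, fun t _ x _ => hC t x, ?_⟩
  · exact (hv.continuous.comp (by fun_prop : Continuous fun t : ℝ => (t, x))).continuousOn
  · simp

theorem exists_forall_hasDerivAt_of_bounded {E : Type*} [NormedAddCommGroup E]
    [NormedSpace ℝ E] [FiniteDimensional ℝ E] {v : ℝ → E → E}
    (hv : ContDiff ℝ 1 (Function.uncurry v)) {C : ℝ≥0} (hC : ∀ t x, ‖v t x‖ ≤ C)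
    (t₀ : ℝ) (x₀ : E) :
    ∃ f : ℝ → E, f t₀ = x₀ ∧ ∀ t, HasDerivAt f (v t (f t)) t := by
  have key (n : ℕ) := exists_hasDerivWithinAt_Icc_of_bounded hv hC t₀ x₀ (n + 1)
  choose α hα₀ hα using key
  push_cast at hα
  have hcont (n : ℕ) : ContinuousOn (α n) (Icc (t₀ - (n + 1)) (t₀ + (n + 1))) :=
    fun t ht => (hα n t ht).continuousWithinAt
  have hder (n : ℕ) : ∀ t ∈ Ioo (t₀ - (n + 1)) (t₀ + (n + 1)), HasDerivAt (α n) (v t (α n t)) t :=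
    fun t ht => (hα n t (Ioo_subset_Icc_self ht)).hasDerivAt (Icc_mem_nhds ht.1 ht.2)
  have hagree {n m : ℕ} (hnm : n ≤ m) :
      EqOn (α n) (α m) (Icc (t₀ - (n + 1)) (t₀ + (n + 1))) := by
    have hnm' : (n : ℝ) ≤ m := by exact_mod_cast hnm
    have hn : (0 : ℝ) ≤ n := n.cast_nonneg
    exact ODE_solution_unique_of_contDiff hv (t₀ := t₀) ⟨by linarith, by linarith⟩ (hcont n)
      (hder n) ((hcont m).mono (Icc_subset_Icc (by linarith) (by linarith)))
      (fun t ht => hder m t ⟨by linarith [ht.1], by linarith [ht.2]⟩) (by rw [hα₀, hα₀])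
  -- Near `t` the glued curve agrees with the solution on an interval that contains `t` in its
  -- interior.
  refine ⟨fun t => α ⌈|t - t₀|⌉₊ t, hα₀ _, fun t => ?_⟩
  set n := ⌈|t - t₀|⌉₊ with hn
  have htn : |t - t₀| ≤ n := Nat.le_ceil _
  have hev : (fun s => α ⌈|s - t₀|⌉₊ s) =ᶠ[𝓝 t] α (n + 1) := by
    have : ∀ᶠ s in 𝓝 t, |s - t₀| < n + 1 :=
      (by fun_prop : Continuous fun s => |s - t₀|).continuousAt.eventually_lt_const (by linarith)
    filter_upwards [this] with s hs
    have hs' : |s - t₀| ≤ ⌈|s - t₀|⌉₊ := Nat.le_ceil _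
    refine hagree (Nat.ceil_le.2 (by push_cast; linarith)) ?_
    constructor <;> linarith [abs_le.1 hs']
  have h1 : α (n + 1) t = α n t :=
    (hagree n.le_succ ⟨by linarith [abs_le.1 htn], by linarith [abs_le.1 htn]⟩).symm
  have h2 := hder (n + 1) t (by
    push_cast; constructor <;> linarith [abs_le.1 htn])
  rw [h1] at h2
  exact h2.congr_of_eventuallyEq hev

/-! ### Cluster points of curves -/

/-- If a curve had two cluster points `p ≠ q`, its distance to `p` would take every value in
`(0, dist q p)` at arbitrarily late times, which would give infinitely many cluster points. -/
theorem exists_tendsto_of_finite_mapClusterPt {X : Type*} [MetricSpace X] {u : ℝ → X}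
    (hu : Continuous u) {K : Set X} (hK : IsCompact K) (huK : ∀ᶠ t in atTop, u t ∈ K)
    {F : Set X} (hF : F.Finite) (huF : ∀ p, MapClusterPt p atTop u → p ∈ F) :
    ∃ p ∈ F, Tendsto u atTop (𝓝 p) := by
  obtain ⟨p, -, hp⟩ := hK.exists_mapClusterPt (Filter.le_principal_iff.2 huK)
  refine ⟨p, huF p hp, hK.tendsto_nhds_of_unique_mapClusterPt huK fun q _ hq => ?_⟩
  by_contra hqp
  have hpos : 0 < dist q p := dist_pos.2 hqp
  obtain ⟨c, hc, hcF⟩ := (Ioo_infinite hpos).exists_notMem_finite (hF.image fun x => dist x p)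
  have hcont : Continuous fun x => dist x p := by fun_prop
  have hlow : ∃ᶠ t in atTop, dist (u t) p < c :=
    hp.frequently (hcont.continuousAt.eventually_lt_const (by simpa using hc.1))
  have hhigh : ∃ᶠ t in atTop, c < dist (u t) p :=
    hq.frequently (hcont.continuousAt.eventually_const_lt hc.2)
  have hlevel : ∃ᶠ t in atTop, dist (u t) p = c := by
    rw [frequently_atTop] at hlow hhigh ⊢
    intro T
    obtain ⟨a, ha, hau⟩ := hlow T
    obtain ⟨b, hb, hbu⟩ := hhigh a
    obtain ⟨t, ht, htc⟩ := intermediate_value_Icc hb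
      (hcont.comp hu).continuousOn
      (show c ∈ Icc (dist (u a) p) (dist (u b) p) from ⟨hau.le, hbu.le⟩)
    exact ⟨t, ha.trans ht.1, htc⟩
  obtain ⟨x, hx, hxu⟩ := (hK.inter_right (isClosed_eq hcont continuous_const :
    IsClosed {x | dist x p = c})).exists_mapClusterPt_of_frequently
      ((hlevel.and_eventually huK).mono fun t ht => ⟨ht.2, ht.1⟩)
  exact hcF ⟨x, huF x hxu, hx.2⟩

/-- A LaSalle-type principle. Near `p` the curve moves at speed at least `c`, so every visit
of the ball of radius `r / 2` costs a fixed amount of energy: the speed is bounded, so there is a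
lower bound for the time until the ball of radius `r` is left. This cannot go on for ever, as the
energy is bounded below. -/
theorem not_mapClusterPt_of_energy {E : Type*} [NormedAddCommGroup E] [NormedSpace ℝ E]
    {U V : ℝ → E} (hU : ∀ t, HasDerivAt U (V t) t) {D : ℝ} (hD : ∀ᶠ t in atTop, ‖V t‖ ≤ D)
    {H H' : ℝ → ℝ} (hH : ∀ t, HasDerivAt H (H' t) t) (hH' : ∀ t, H' t ≤ -‖V t‖ ^ 2)
    (hbdd : BddBelow (range H)) {p : E} {r c : ℝ} (hr : 0 < r) (hc : 0 < c)
    (hV : ∀ᶠ t in atTop, U t ∈ ball p r → c ≤ ‖V t‖) : ¬ MapClusterPt p atTop U := by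
  intro hp
  have hanti : Antitone H := antitone_of_deriv_nonpos (fun t => (hH t).differentiableAt)
    fun t => by rw [(hH t).deriv]; exact (hH' t).trans (by simp)
  obtain ⟨T, hT⟩ := eventually_atTop.1 (hD.and hV)
  -- The maximum makes the bound on the speed positive, so that the duration `δ` is well defined.
  set D' := max D 1 with hD'
  have hDpos : 0 < D' := lt_max_of_lt_right one_pos
  set δ := r / (2 * D') with hδ
  have hδpos : 0 < δ := by positivity
  have hlim := tendsto_atTop_ciInf hanti hbdd
  have hlim' : Tendsto (fun t => H t - H (t + δ)) atTop (𝓝 0) := by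
    simpa using hlim.sub (hlim.comp (tendsto_atTop_add_const_right _ δ tendsto_id))
  have hsmall : ∀ᶠ t in atTop, H t - H (t + δ) < c ^ 2 * δ :=
    hlim'.eventually_lt_const (by positivity)
  have hvisit : ∃ᶠ t in atTop, U t ∈ ball p (r / 2) :=
    hp.frequently (ball_mem_nhds p (by positivity))
  obtain ⟨t, htU, hts, htT⟩ :=
    (hvisit.and_eventually (hsmall.and (eventually_ge_atTop T))).exists
  have hstay : ∀ s ∈ Icc t (t + δ), U s ∈ ball p r := by
    intro s hs
    have hmove : ‖U s - U t‖ ≤ D' * (s - t) :=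
      norm_image_sub_le_of_norm_deriv_le_segment' (fun x _ => (hU x).hasDerivWithinAt)
        (fun x hx => (hT x (htT.trans hx.1)).1.trans (le_max_left _ _)) s (right_mem_Icc.2 hs.1)
    have : D' * (s - t) ≤ r / 2 := by
      calc D' * (s - t) ≤ D' * δ := by gcongr; linarith [hs.2]
        _ = r / 2 := by rw [hδ]; field_simp
    rw [mem_ball] at htU ⊢
    calc dist (U s) p ≤ dist (U s) (U t) + dist (U t) p := dist_triangle _ _ _
      _ < r := by rw [dist_eq_norm (U s)]; linarith
  have hdrop : H (t + δ) - H t ≤ -c ^ 2 * (t + δ - t) := by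
    refine Convex.image_sub_le_mul_sub_of_deriv_le (convex_Icc t (t + δ))
      (fun s _ => (hH s).continuousAt.continuousWithinAt)
      (fun s _ => (hH s).differentiableAt.differentiableWithinAt) (fun s hs => ?_) t
      (left_mem_Icc.2 (by linarith)) (t + δ) (right_mem_Icc.2 (by linarith)) (by linarith)
    have hs' := interior_subset hs
    rw [(hH s).deriv]
    have := (hT s (htT.trans hs'.1)).2 (hstay s hs')
    have : c ^ 2 ≤ ‖V s‖ ^ 2 := by gcongr
    linarith [hH' s]
  rw [add_sub_cancel_left] at hdrop
  linarith

/-! ### Critical points of the distance to the data -/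

section

variable {E : Type*} [NormedAddCommGroup E] [InnerProductSpace ℝ E] {ι : Type*}

/-- The indices of the data points at minimal distance from `u`. -/
def nearestIndices (y : ι → E) (u : E) : Set ι := {i | ∀ j, ‖u - y i‖ ≤ ‖u - y j‖}

/-- A critical point of the distance to the data set `range y`: a point in the convex hull of the
data points nearest to it. -/
def IsCriticalPoint (y : ι → E) (u : E) : Prop :=
  u ∈ convexHull ℝ (y '' nearestIndices y u)

/-- A critical point is the circumcentre of the data points nearest to it within their affine
span, so it is determined by the set of their indices. -/
theorem IsCriticalPoint.eq_of_nearestIndices_eq {y : ι → E} {u v : E} (hu : IsCriticalPoint y u)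
    (hv : IsCriticalPoint y v) (h : nearestIndices y u = nearestIndices y v) : u = v := by
  unfold IsCriticalPoint at hu hv
  rw [← h] at hv
  obtain ⟨_, i, hi, -⟩ := convexHull_nonempty_iff.1 ⟨u, hu⟩
  have hlevel : convexHull ℝ (y '' nearestIndices y u) ⊆
      {x | inner ℝ (u - v) x = inner ℝ (u - v) (y i)} := by
    refine convexHull_min ?_ (convex_hyperplane (innerₛₗ ℝ (u - v)).isLinear _)
    rintro _ ⟨j, hj, rfl⟩
    have h1 : ‖u - y i‖ = ‖u - y j‖ := le_antisymm (hi j) (hj i)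
    have h2 : ‖v - y i‖ = ‖v - y j‖ := le_antisymm ((h ▸ hi : i ∈ nearestIndices y v) j)
      ((h ▸ hj : j ∈ nearestIndices y v) i)
    have h1' := congrArg (· ^ 2) h1
    have h2' := congrArg (· ^ 2) h2
    simp only [norm_sub_sq_real] at h1' h2'
    simp only [mem_ofPred_eq, inner_sub_left]
    linarith
  have huv : inner ℝ (u - v) (u - v) = 0 := by
    rw [inner_sub_right, (hlevel hu : inner ℝ (u - v) u = _), (hlevel hv : inner ℝ (u - v) v = _),
      sub_self]
  exact sub_eq_zero.1 (inner_self_eq_zero.1 huv)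

theorem finite_setOf_isCriticalPoint [Finite ι] (y : ι → E) : {u | IsCriticalPoint y u}.Finite :=
  Set.Finite.of_finite_image (f := nearestIndices y) (toFinite _)
    fun _ hu _ hv h => IsCriticalPoint.eq_of_nearestIndices_eq hu hv h

theorem finite_of_forall_isCriticalPoint [Finite ι] {y : ι → E} {s : Set E}
    (hs : ∀ u ∈ s, IsCriticalPoint y u) : s.Finite :=
  (finite_setOf_isCriticalPoint y).subset hs

/-! ### Gaussian softmax weights and their mean -/

variable [Fintype ι]

/-- The posterior weight `exp (-‖z - s y i‖² / 2) / ∑ j, exp (-‖z - s y j‖² / 2)` of the data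
point `y i` given the position `z` at time `s`. -/
noncomputable def gaussWeight (y : ι → E) (s : ℝ) (z : E) (i : ι) : ℝ :=
  Real.exp (-‖z - s • y i‖ ^ 2 / 2) / ∑ j, Real.exp (-‖z - s • y j‖ ^ 2 / 2)

/-- The posterior mean: the average of the data points with respect to `gaussWeight`. -/
noncomputable def gaussMean (y : ι → E) (s : ℝ) (z : E) : E :=
  ∑ i, gaussWeight y s z i • y i

theorem sum_exp_pos [Nonempty ι] (f : ι → ℝ) : 0 < ∑ j, Real.exp (f j) :=
  Finset.sum_pos (fun _ _ => Real.exp_pos _) Finset.univ_nonempty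

theorem gaussWeight_nonneg (y : ι → E) (s : ℝ) (z : E) (i : ι) : 0 ≤ gaussWeight y s z i := by
  unfold gaussWeight; positivity

theorem gaussWeight_pos [Nonempty ι] (y : ι → E) (s : ℝ) (z : E) (i : ι) :
    0 < gaussWeight y s z i :=
  div_pos (Real.exp_pos _) (sum_exp_pos _)

theorem sum_gaussWeight [Nonempty ι] (y : ι → E) (s : ℝ) (z : E) :
    ∑ i, gaussWeight y s z i = 1 := by
  unfold gaussWeight
  rw [← Finset.sum_div, div_self (sum_exp_pos _).ne']

theorem gaussWeight_le_one (y : ι → E) (s : ℝ) (z : E) (i : ι) : gaussWeight y s z i ≤ 1 := by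
  refine div_le_one_of_le₀ ?_ (by positivity)
  exact Finset.single_le_sum (f := fun j => Real.exp (-‖z - s • y j‖ ^ 2 / 2))
    (fun _ _ => (Real.exp_pos _).le) (Finset.mem_univ i)

theorem norm_gaussMean_le (y : ι → E) (s : ℝ) (z : E) : ‖gaussMean y s z‖ ≤ ∑ i, ‖y i‖ := by
  refine norm_sum_le_of_le _ fun i _ => ?_
  rw [norm_smul, Real.norm_of_nonneg (gaussWeight_nonneg y s z i)]
  exact mul_le_of_le_one_left (norm_nonneg _) (gaussWeight_le_one y s z i)

theorem contDiff_gaussMean [Nonempty ι] (y : ι → E) {n : WithTop ℕ∞} :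
    ContDiff ℝ n (Function.uncurry (gaussMean y)) := by
  have h (i : ι) : ContDiff ℝ n fun p : ℝ × E => Real.exp (-‖p.2 - p.1 • y i‖ ^ 2 / 2) :=
    ((((contDiff_snd.sub (contDiff_fst.smul contDiff_const)).norm_sq ℝ).neg).div_const 2).exp
  exact ContDiff.sum fun i _ =>
    ((h i).div (ContDiff.sum fun j _ => h j) fun p => (sum_exp_pos _).ne').smul contDiff_const

theorem sum_gaussWeight_mul_inner (y : ι → E) (s : ℝ) (z v : E) :
    ∑ i, gaussWeight y s z i * inner ℝ v (y i) = inner ℝ v (gaussMean y s z) := by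
  simp [gaussMean, inner_sum, inner_smul_right]

/-- The weights at position `s • u` concentrate on the data points nearest to `u`
as `s → ∞`, locally uniformly in `u`. -/
theorem tendsto_gaussWeight_of_notMem_nearestIndices (y : ι → E) {u : E} {i : ι}
    (hi : i ∉ nearestIndices y u) :
    Tendsto (fun p : ℝ × E => gaussWeight y p.1 (p.1 • p.2) i) (atTop ×ˢ 𝓝 u) (𝓝 0) := by
  simp only [nearestIndices, mem_ofPred_eq, not_forall, not_le] at hi
  obtain ⟨j, hj⟩ := hi
  have hgap : Tendsto (fun p : ℝ × E => (‖p.2 - y i‖ ^ 2 - ‖p.2 - y j‖ ^ 2) / 2) (atTop ×ˢ 𝓝 u)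
      (𝓝 ((‖u - y i‖ ^ 2 - ‖u - y j‖ ^ 2) / 2)) :=
    ((by fun_prop : Continuous fun x : E => (‖x - y i‖ ^ 2 - ‖x - y j‖ ^ 2) / 2).tendsto u).comp
      tendsto_snd
  have hpos : 0 < (‖u - y i‖ ^ 2 - ‖u - y j‖ ^ 2) / 2 := by
    have : ‖u - y j‖ ^ 2 < ‖u - y i‖ ^ 2 := by gcongr
    linarith
  have hsq : Tendsto (fun p : ℝ × E => p.1 ^ 2) (atTop ×ˢ 𝓝 u) atTop :=
    (tendsto_pow_atTop two_ne_zero).comp tendsto_fst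
  refine squeeze_zero (fun p => gaussWeight_nonneg y _ _ i) (fun p => ?_)
    (Real.tendsto_exp_neg_atTop_nhds_zero.comp (hsq.atTop_mul_pos hpos hgap))
  have hden : Real.exp (-‖p.1 • p.2 - p.1 • y j‖ ^ 2 / 2) ≤
      ∑ k, Real.exp (-‖p.1 • p.2 - p.1 • y k‖ ^ 2 / 2) :=
    Finset.single_le_sum (f := fun k => Real.exp (-‖p.1 • p.2 - p.1 • y k‖ ^ 2 / 2))
      (fun _ _ => (Real.exp_pos _).le) (Finset.mem_univ j)
  refine (div_le_div_of_nonneg_left (Real.exp_pos _).le (Real.exp_pos _) hden).trans_eq ?_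
  rw [← Real.exp_sub, Function.comp_apply]
  simp only [← smul_sub, norm_smul, mul_pow, Real.norm_eq_abs, sq_abs]
  ring_nf

theorem tendsto_gaussMean_of_forall_eq [Nonempty ι] (y : ι → E) {u a : E}
    (h : ∀ i ∈ nearestIndices y u, y i = a) :
    Tendsto (fun p : ℝ × E => gaussMean y p.1 (p.1 • p.2)) (atTop ×ˢ 𝓝 u) (𝓝 a) := by
  have key : Tendsto (fun p : ℝ × E => ∑ i, gaussWeight y p.1 (p.1 • p.2) i • (y i - a))
      (atTop ×ˢ 𝓝 u) (𝓝 (∑ _i : ι, 0)) := by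
    refine tendsto_finsetSum _ fun i _ => ?_
    by_cases hi : i ∈ nearestIndices y u
    · simp [h i hi]
    · simpa using (tendsto_gaussWeight_of_notMem_nearestIndices y hi).smul_const (y i - a)
  have := key.add_const a
  simp only [Finset.sum_const_zero, zero_add] at this
  refine this.congr fun p => ?_
  simp only [smul_sub, Finset.sum_sub_distrib, ← Finset.sum_smul, sum_gaussWeight, one_smul,
    sub_add_cancel, gaussMean]

/-- Away from critical points the mean of the weights at position `s • u` differs from `u`: a linear
functional separates the point from the convex hull of its nearest data points, which carry
asymptotically all of the weight. -/
theorem exists_eventually_le_norm_gaussMean_sub [Nonempty ι] {y : ι → E} {u : E}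
    (hu : ¬ IsCriticalPoint y u) :
    ∃ c > 0, ∀ᶠ p : ℝ × E in atTop ×ˢ 𝓝 u, c ≤ ‖gaussMean y p.1 (p.1 • p.2) - p.2‖ := by
  obtain ⟨f, a, hfu, hfa⟩ := geometric_hahn_banach_point_closed (convex_convexHull ℝ _)
    (((toFinite (nearestIndices y u)).image y).isClosed_convexHull ℝ) hu
  have key : Tendsto (fun p : ℝ × E => ∑ i, gaussWeight y p.1 (p.1 • p.2) i *
      min (f (y i) - a) 0) (atTop ×ˢ 𝓝 u) (𝓝 (∑ _i : ι, 0)) := by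
    refine tendsto_finsetSum _ fun i _ => ?_
    by_cases hi : i ∈ nearestIndices y u
    · have := hfa (y i) (subset_convexHull ℝ _ (mem_image_of_mem y hi))
      simp [min_eq_right (sub_nonneg.2 this.le)]
    · simpa using (tendsto_gaussWeight_of_notMem_nearestIndices y hi).mul_const
        (min (f (y i) - a) 0)
  have hf : Tendsto (fun p : ℝ × E => a - f p.2) (atTop ×ˢ 𝓝 u) (𝓝 (a - f u)) :=
    ((by fun_prop : Continuous fun x => a - f x).tendsto u).comp tendsto_snd
  have hsum := key.add hf
  simp only [Finset.sum_const_zero, zero_add] at hsum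
  have hgap : 0 < a - f u := sub_pos.2 hfu
  refine ⟨(a - f u) / 2 / (‖f‖ + 1), by positivity, ?_⟩
  filter_upwards [hsum.eventually_const_le (half_lt_self hgap)] with p hp
  rw [div_le_iff₀ (by positivity)]
  set m := gaussMean y p.1 (p.1 • p.2) with hm
  have hfm : f m - a = ∑ i, gaussWeight y p.1 (p.1 • p.2) i * (f (y i) - a) := by
    simp only [mul_sub, Finset.sum_sub_distrib, ← Finset.sum_mul, sum_gaussWeight, one_mul]
    simp [hm, gaussMean, map_sum]
  have hle : ∑ i, gaussWeight y p.1 (p.1 • p.2) i * min (f (y i) - a) 0 ≤ f m - a := by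
    rw [hfm]
    gcongr with i
    · exact gaussWeight_nonneg y _ _ i
    · exact min_le_left _ _
  calc (a - f u) / 2 ≤ f (m - p.2) := by rw [map_sub]; linarith
    _ ≤ ‖f‖ * ‖m - p.2‖ := (le_abs_self _).trans (f.le_opNorm _)
    _ ≤ ‖m - p.2‖ * (‖f‖ + 1) := by nlinarith [norm_nonneg (m - p.2)]

end

/-! ### Energy dissipation and convergence of the rescaled flow -/

section

variable {E : Type*} [NormedAddCommGroup E] [InnerProductSpace ℝ E] {ι : Type*} [Fintype ι]

/-- The entropy of the weights, written through the log-partition function, is bounded by the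
number of data points, since `-w * log w ≤ 1` for each weight `w`. -/
theorem log_sum_exp_sub_le [Nonempty ι] (y : ι → E) (s : ℝ) (z : E) :
    Real.log (∑ j, Real.exp (-‖z - s • y j‖ ^ 2 / 2)) -
      ∑ i, gaussWeight y s z i * (-‖z - s • y i‖ ^ 2 / 2) ≤ Fintype.card ι := by
  set L := Real.log (∑ j, Real.exp (-‖z - s • y j‖ ^ 2 / 2)) with hL
  have hterm (i : ι) : gaussWeight y s z i * (L - -‖z - s • y i‖ ^ 2 / 2) ≤ 1 := by
    have hw := gaussWeight_pos y s z i
    have hlog : Real.log (gaussWeight y s z i) = -‖z - s • y i‖ ^ 2 / 2 - L := by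
      rw [gaussWeight, Real.log_div (Real.exp_pos _).ne' (sum_exp_pos _).ne', Real.log_exp]
    have h := mul_le_mul_of_nonneg_left (Real.one_sub_inv_le_log_of_pos hw) hw.le
    rw [hlog, mul_sub, mul_one, mul_inv_cancel₀ hw.ne'] at h
    linarith
  calc _ = ∑ i, gaussWeight y s z i * (L - -‖z - s • y i‖ ^ 2 / 2) := by
        simp only [mul_sub, Finset.sum_sub_distrib, ← Finset.sum_mul, sum_gaussWeight, one_mul]
    _ ≤ ∑ _i : ι, (1 : ℝ) := Finset.sum_le_sum fun i _ => hterm i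
    _ = Fintype.card ι := by simp

/-- The energy at position `z` and logarithmic time `t`. With `s = exp t` and `u = z / s` it is
`-s⁻² * log ∑ j, exp (-s² ‖u - y j‖² / 2)`, a smooth approximation of half the squared distance from
`u` to the data, plus the correction `card ι * s⁻²` that makes it decrease along the flow. -/
noncomputable def flowEnergy (y : ι → E) (t : ℝ) (z : E) : ℝ :=
  Real.exp (-2 * t) *
    (Fintype.card ι - Real.log (∑ j, Real.exp (-‖z - Real.exp t • y j‖ ^ 2 / 2)))

theorem flowEnergy_nonneg [Nonempty ι] (y : ι → E) (t : ℝ) (z : E) : 0 ≤ flowEnergy y t z := by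
  refine mul_nonneg (Real.exp_pos _).le (sub_nonneg.2 ?_)
  have hle : ∑ j, Real.exp (-‖z - Real.exp t • y j‖ ^ 2 / 2) ≤ Fintype.card ι := by
    calc _ ≤ ∑ _j : ι, (1 : ℝ) := Finset.sum_le_sum fun j _ =>
          Real.exp_le_one_iff.2 (by have := sq_nonneg ‖z - Real.exp t • y j‖; linarith)
      _ = Fintype.card ι := by simp
  exact (Real.log_le_sub_one_of_pos (sum_exp_pos _)).trans (by linarith)

/-- In logarithmic time `t`, with `s = exp t`, the curve `u = z / s` satisfies `u' = m - u`. -/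
theorem hasDerivAt_rescaled {y : ι → E} {z : ℝ → E}
    (hz : ∀ s, HasDerivAt z (gaussMean y s (z s)) s) (t : ℝ) :
    HasDerivAt (fun t => Real.exp (-t) • z (Real.exp t))
      (gaussMean y (Real.exp t) (z (Real.exp t)) - Real.exp (-t) • z (Real.exp t)) t := by
  have h1 := (hz (Real.exp t)).scomp t (Real.hasDerivAt_exp t)
  have h2 : HasDerivAt (fun t => Real.exp (-t)) (-Real.exp (-t)) t := by
    simpa using (hasDerivAt_neg t).exp
  have h3 := h2.smul h1
  rw [smul_smul, ← Real.exp_add, neg_add_cancel, Real.exp_zero, one_smul, neg_smul,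
    ← sub_eq_add_neg] at h3
  exact h3

/-- The energy decreases along the flow at rate at least `‖u'‖²`, where `u = z / s`. Up to the
factor `exp (-2 * t)`, the explicit time dependence contributes twice the entropy of the weights
minus `2 * card ι`, which is not positive. -/
theorem exists_hasDerivAt_flowEnergy_le [Nonempty ι] {y : ι → E} {z : ℝ → E}
    (hz : ∀ s, HasDerivAt z (gaussMean y s (z s)) s) (t : ℝ) :
    ∃ e, HasDerivAt (fun t => flowEnergy y t (z (Real.exp t))) e t ∧
      e ≤ -‖gaussMean y (Real.exp t) (z (Real.exp t)) - Real.exp (-t) • z (Real.exp t)‖ ^ 2 := by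
  set σ := Real.exp t with hσ
  set Z := z σ with hZ
  set m := gaussMean y σ Z with hm
  have hZ' := (hz (Real.exp t)).scomp t (Real.hasDerivAt_exp t)
  have ha (i : ι) : HasDerivAt (fun t => -‖z (Real.exp t) - Real.exp t • y i‖ ^ 2 / 2)
      (-σ * inner ℝ (Z - σ • y i) (m - y i)) t := by
    have h := ((hZ'.sub ((Real.hasDerivAt_exp t).smul_const (y i))).norm_sq.neg).div_const 2
    convert! h using 1
    rw [← hσ, ← hZ, ← hm, ← smul_sub, inner_smul_right]
    simp only [Pi.sub_apply, Function.comp_apply, ← hσ, ← hZ]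
    ring
  have hlog := (HasDerivAt.fun_sum (u := Finset.univ) fun i _ => (ha i).exp).log (sum_exp_pos _).ne'
  have hexp : HasDerivAt (fun t => Real.exp (-2 * t)) (Real.exp (-2 * t) * (-2)) t := by
    simpa using ((hasDerivAt_id t).const_mul (-2)).exp
  refine ⟨_, hexp.mul (hlog.const_sub (Fintype.card ι : ℝ)), ?_⟩
  have hent := log_sum_exp_sub_le y σ Z
  set L := Real.log (∑ j, Real.exp (-‖Z - σ • y j‖ ^ 2 / 2)) with hL
  have hdL : (∑ i, Real.exp (-‖Z - σ • y i‖ ^ 2 / 2) * (-σ * inner ℝ (Z - σ • y i) (m - y i))) /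
      (∑ j, Real.exp (-‖Z - σ • y j‖ ^ 2 / 2)) =
      ∑ i, gaussWeight y σ Z i * (-σ * inner ℝ (Z - σ • y i) (m - y i)) := by
    rw [Finset.sum_div]
    exact Finset.sum_congr rfl fun i _ => by rw [gaussWeight]; ring
  -- The second moment `S` of the data cancels between the entropy bound and the drift.
  set S := ∑ i, gaussWeight y σ Z i * ‖y i‖ ^ 2 with hS
  have hone := sum_gaussWeight y σ Z
  have hinner (v : E) : ∑ i, gaussWeight y σ Z i * inner ℝ v (y i) = inner ℝ v m :=
    sum_gaussWeight_mul_inner y σ Z v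
  have hmean : ∑ i, gaussWeight y σ Z i * (-‖Z - σ • y i‖ ^ 2 / 2) =
      -(‖Z‖ ^ 2 - 2 * σ * inner ℝ Z m + σ ^ 2 * S) / 2 := by
    have (i : ι) : gaussWeight y σ Z i * (-‖Z - σ • y i‖ ^ 2 / 2) =
        -‖Z‖ ^ 2 / 2 * gaussWeight y σ Z i + σ * (gaussWeight y σ Z i * inner ℝ Z (y i)) -
          σ ^ 2 / 2 * (gaussWeight y σ Z i * ‖y i‖ ^ 2) := by
      rw [norm_sub_sq_real, norm_smul, inner_smul_right, mul_pow, Real.norm_eq_abs, sq_abs]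
      ring
    simp only [this, Finset.sum_sub_distrib, Finset.sum_add_distrib, ← Finset.mul_sum, hone,
      hinner, ← hS]
    ring
  have hdrift : ∑ i, gaussWeight y σ Z i * (-σ * inner ℝ (Z - σ • y i) (m - y i)) =
      σ ^ 2 * (‖m‖ ^ 2 - S) := by
    have (i : ι) : gaussWeight y σ Z i * (-σ * inner ℝ (Z - σ • y i) (m - y i)) =
        -σ * inner ℝ Z m * gaussWeight y σ Z i + σ * (gaussWeight y σ Z i * inner ℝ Z (y i)) +
        σ ^ 2 * (gaussWeight y σ Z i * inner ℝ m (y i)) -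
        σ ^ 2 * (gaussWeight y σ Z i * ‖y i‖ ^ 2) := by
      simp only [inner_sub_left, inner_sub_right, real_inner_smul_left,
        real_inner_self_eq_norm_sq, real_inner_comm m (y i)]
      ring
    simp only [this, Finset.sum_sub_distrib, Finset.sum_add_distrib, ← Finset.mul_sum, hone,
      hinner, ← hS, real_inner_self_eq_norm_sq]
    ring
  rw [← hσ, ← hZ, hdL, hdrift]
  rw [hmean] at hent
  have hσ2 : Real.exp (-2 * t) * σ ^ 2 = 1 := by
    rw [hσ, ← Real.exp_nat_mul, ← Real.exp_add]; simp
  have hσ1 : Real.exp (-t) = Real.exp (-2 * t) * σ := by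
    rw [hσ, ← Real.exp_add]; ring_nf
  have hnorm : ‖m - Real.exp (-t) • Z‖ ^ 2 =
      Real.exp (-2 * t) * (‖Z‖ ^ 2 - 2 * σ * inner ℝ Z m + σ ^ 2 * ‖m‖ ^ 2) := by
    rw [norm_sub_sq_real, norm_smul, inner_smul_right, mul_pow, Real.norm_eq_abs, sq_abs, hσ1,
      real_inner_comm]
    linear_combination (Real.exp (-2 * t) * ‖Z‖ ^ 2 - ‖m‖ ^ 2) * hσ2
  rw [hnorm]
  have hpos := Real.exp_pos (-2 * t)
  nlinarith [mul_le_mul_of_nonneg_left hent hpos.le]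

theorem norm_rescaled_le {y : ι → E} {z : ℝ → E}
    (hz : ∀ s, HasDerivAt z (gaussMean y s (z s)) s) {t : ℝ} (ht : 0 ≤ t) :
    ‖Real.exp (-t) • z (Real.exp t)‖ ≤ ‖z 0‖ + ∑ i, ‖y i‖ := by
  have hmove := norm_image_sub_le_of_norm_deriv_le_segment' (a := 0) (b := Real.exp t)
    (fun x _ => (hz x).hasDerivWithinAt) (fun x _ => norm_gaussMean_le y x (z x)) (Real.exp t)
    (right_mem_Icc.2 (Real.exp_pos t).le)
  have h1 : Real.exp (-t) ≤ 1 := Real.exp_le_one_iff.2 (by linarith)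
  have h2 : Real.exp (-t) * Real.exp t = 1 := by rw [← Real.exp_add]; simp
  rw [norm_smul, Real.norm_of_nonneg (Real.exp_pos _).le]
  calc Real.exp (-t) * ‖z (Real.exp t)‖
      ≤ Real.exp (-t) * (‖z 0‖ + (∑ i, ‖y i‖) * Real.exp t) := by
        gcongr
        have := norm_sub_norm_le (z (Real.exp t)) (z 0)
        rw [sub_zero] at hmove
        linarith
    _ = Real.exp (-t) * ‖z 0‖ + ∑ i, ‖y i‖ := by linear_combination (∑ i, ‖y i‖) * h2
    _ ≤ ‖z 0‖ + ∑ i, ‖y i‖ := by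
        gcongr
        exact mul_le_of_le_one_left (norm_nonneg _) h1

/-- In logarithmic time the curve `u = z / s` is bounded and dissipates energy, so its cluster
points are critical points, of which there are finitely many. -/
theorem exists_isCriticalPoint_tendsto [FiniteDimensional ℝ E] [Nonempty ι] {y : ι → E}
    {z : ℝ → E} (hz : ∀ s, HasDerivAt z (gaussMean y s (z s)) s) :
    ∃ p, IsCriticalPoint y p ∧ Tendsto (fun s => s⁻¹ • z s) atTop (𝓝 p) := by
  have := FiniteDimensional.proper_real E
  choose e he hele using exists_hasDerivAt_flowEnergy_le hz
  have hU := hasDerivAt_rescaled hz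
  set U : ℝ → E := fun t => Real.exp (-t) • z (Real.exp t) with hUdef
  have hbound : ∀ᶠ t in atTop, ‖U t‖ ≤ ‖z 0‖ + ∑ i, ‖y i‖ := by
    filter_upwards [eventually_ge_atTop 0] with t ht using norm_rescaled_le hz ht
  obtain ⟨p, hp, hlim⟩ := exists_tendsto_of_finite_mapClusterPt
    (continuous_iff_continuousAt.2 fun t => (hU t).continuousAt)
    (isCompact_closedBall (0 : E) (‖z 0‖ + ∑ i, ‖y i‖))
    (hbound.mono fun t ht => by simpa using ht) (finite_setOf_isCriticalPoint y) (fun p hp => by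
      by_contra hcrit
      obtain ⟨c, hc, hev⟩ := exists_eventually_le_norm_gaussMean_sub hcrit
      obtain ⟨P, hP, Q, hQ, hPQ⟩ := eventually_prod_iff.1 hev
      obtain ⟨r, hr, hrQ⟩ := Metric.mem_nhds_iff.1 hQ
      refine not_mapClusterPt_of_energy hU
        (D := ∑ i, ‖y i‖ + (‖z 0‖ + ∑ i, ‖y i‖)) ?_ he hele
        ⟨0, by rintro _ ⟨t, rfl⟩; exact flowEnergy_nonneg y _ _⟩ hr hc ?_ hp
      · filter_upwards [hbound] with t ht
        exact (norm_sub_le _ _).trans (add_le_add (norm_gaussMean_le _ _ _) ht)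
      · filter_upwards [Real.tendsto_exp_atTop.eventually hP] with t ht hball
        have := hPQ ht (hrQ hball)
        simpa [hUdef, smul_smul, ← Real.exp_add] using this)
  refine ⟨p, hp, (hlim.comp Real.tendsto_log_atTop).congr' ?_⟩
  filter_upwards [eventually_gt_atTop 0] with s hs
  simp [hUdef, Real.exp_neg, Real.exp_log hs]

/-! ### Every data point is reached -/

/-- If `r` is less than half the distance from `a = y i` to the other data points, then at
late times the cone `‖z - s • a‖ ≤ r * s` cannot be left, because the drift of `z - s • a` is
shorter than `r` on it. The solution through `s₀ • a` therefore satisfies `‖z / s - a‖ ≤ r`, and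
`a` is the only critical point that close to `a`. -/
theorem exists_forall_hasDerivAt_tendsto [FiniteDimensional ℝ E] [Nonempty ι] (y : ι → E) (i : ι) :
    ∃ z : ℝ → E, (∀ s, HasDerivAt z (gaussMean y s (z s)) s) ∧
      Tendsto (fun s => s⁻¹ • z s) atTop (𝓝 (y i)) := by
  have := FiniteDimensional.proper_real E
  have hnear : ∀ᶠ u in 𝓝 (y i), ∀ j, y j ≠ y i → ‖u - y i‖ < ‖u - y j‖ := by
    refine eventually_all.2 fun j => ?_
    by_cases hj : y j = y i
    · simp [hj]
    have h : ∀ᶠ u in 𝓝 (y i), ‖u - y i‖ < ‖u - y j‖ :=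
      (by fun_prop : Continuous fun u => ‖u - y i‖).continuousAt.eventually_lt
        (by fun_prop : Continuous fun u => ‖u - y j‖).continuousAt
        (by simpa [sub_eq_zero] using fun h => hj h.symm)
    exact h.mono fun u hu _ => hu
  obtain ⟨r, hr, hball⟩ := Metric.nhds_basis_closedBall.eventually_iff.1 hnear
  have hidx {u : E} (hu : u ∈ closedBall (y i) r) : ∀ j ∈ nearestIndices y u, y j = y i :=
    fun j hj => by_contra fun h => (hball hu j h).not_ge (hj i)
  have hev : {p : ℝ × E | ‖gaussMean y p.1 (p.1 • p.2) - y i‖ < r} ∈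
      atTop ×ˢ 𝓝ˢ (closedBall (y i) r) :=
    (isCompact_closedBall (y i) r).mem_prod_nhdsSet_of_forall fun u hu =>
      ((tendsto_gaussMean_of_forall_eq y (hidx hu)).sub_const (y i)).norm.eventually_lt_const
        (by simpa using hr)
  obtain ⟨P, hP, Q, hQ, hPQ⟩ := eventually_prod_iff.1 (show ∀ᶠ p in _, _ from hev)
  obtain ⟨s₁, hs₁⟩ := eventually_atTop.1 hP
  set s₀ := max s₁ 1 with hs₀
  have hs₀pos : 0 < s₀ := lt_max_of_lt_right one_pos
  obtain ⟨z, hz₀, hz⟩ := exists_forall_hasDerivAt_of_bounded (contDiff_gaussMean y)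
    (C := ∑ i, ‖y i‖₊) (fun t x => by simpa using norm_gaussMean_le y t x) s₀ (s₀ • y i)
  refine ⟨z, hz, ?_⟩
  obtain ⟨p, hp, hlim⟩ := exists_isCriticalPoint_tendsto hz
  have hinv : ∀ s, s₀ ≤ s → ‖z s - s • y i‖ ≤ r * s := by
    intro s hs
    have hder (x : ℝ) : HasDerivAt (fun s => z s - s • y i) (gaussMean y x (z x) - y i) x := by
      simpa using (hz x).fun_sub ((hasDerivAt_id x).smul_const (y i))
    refine image_norm_le_of_norm_deriv_right_lt_deriv_boundary (a := s₀) (b := s)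
      (B := fun s => r * s) (B' := fun _ => r)
      (fun x _ => (hder x).continuousAt.continuousWithinAt)
      (fun x _ => (hder x).hasDerivWithinAt) ?_ (fun x => ?_) (fun x hx hxr => ?_)
      (right_mem_Icc.2 hs)
    · simp only [hz₀, sub_self, norm_zero]; positivity
    · simpa using (hasDerivAt_id x).const_mul r
    · have hx0 : 0 < x := hs₀pos.trans_le hx.1
      have hmem : x⁻¹ • z x ∈ closedBall (y i) r := by
        rw [mem_closedBall, dist_eq_norm]
        have : x⁻¹ • z x - y i = x⁻¹ • (z x - x • y i) := by
          rw [smul_sub, inv_smul_smul₀ hx0.ne']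
        rw [this, norm_smul, hxr, norm_inv, Real.norm_of_nonneg hx0.le]
        exact (by field_simp : x⁻¹ * (r * x) = r).le
      have h := hPQ (hs₁ x ((le_max_left _ _).trans hx.1)) (subset_of_mem_nhdsSet hQ hmem)
      simpa [smul_inv_smul₀ hx0.ne'] using h
  have hpr : p ∈ closedBall (y i) r := by
    refine isClosed_closedBall.mem_of_tendsto hlim ?_
    filter_upwards [eventually_ge_atTop s₀] with s hs
    have hs0 : 0 < s := hs₀pos.trans_le hs
    have : s⁻¹ • z s - y i = s⁻¹ • (z s - s • y i) := by
      rw [smul_sub, inv_smul_smul₀ hs0.ne']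
    rw [mem_closedBall, dist_eq_norm, this, norm_smul, norm_inv, Real.norm_of_nonneg hs0.le]
    rw [inv_mul_le_iff₀ hs0, mul_comm]
    exact hinv s hs
  have hpi : p = y i := by
    have : convexHull ℝ (y '' nearestIndices y p) ⊆ {y i} :=
      convexHull_min (by rintro _ ⟨j, hj, rfl⟩; exact hidx hpr j hj) (convex_singleton _)
    exact this hp
  exact hpi ▸ hlim

end

/-! ### The change of variables `s = t / (1 - t)`, `z = x / (1 - t)` -/

/-- In the variables `s = t / (1 - t)` and `z = x / (1 - t)` one has
`(x - t • y i) / (1 - t) = z - s • y i`. -/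
theorem otWeight_eq_gaussWeight {d N : ℕ} (y : Fin N → EuclideanSpace ℝ (Fin d)) (t : ℝ)
    (x : EuclideanSpace ℝ (Fin d)) (i : Fin N) :
    otWeight y t x i = gaussWeight y (t / (1 - t)) ((1 - t)⁻¹ • x) i := by
  simp only [otWeight, gaussWeight, smul_sub, smul_smul, div_eq_inv_mul]

theorem optimalVelocity_eq {d N : ℕ} [NeZero N] (y : Fin N → EuclideanSpace ℝ (Fin d)) (t : ℝ)
    (x : EuclideanSpace ℝ (Fin d)) :
    optimalVelocity y t x =
      (1 - t)⁻¹ • (gaussMean y (t / (1 - t)) ((1 - t)⁻¹ • x) - x) := by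
  simp only [optimalVelocity, gaussMean, otWeight_eq_gaussWeight, smul_comm _ (1 - t)⁻¹,
    ← Finset.smul_sum]
  simp only [smul_sub, Finset.sum_sub_distrib, ← Finset.sum_smul, sum_gaussWeight, one_smul]

theorem hasDerivAt_div_one_sub {t : ℝ} (ht : t < 1) :
    HasDerivAt (fun t : ℝ => t / (1 - t)) ((1 - t)⁻¹ ^ 2) t := by
  have h : (1 : ℝ) - t ≠ 0 := by linarith
  refine ((hasDerivAt_id t).div ((hasDerivAt_id t).const_sub 1) h).congr_deriv ?_
  simp only [id]
  field_simp
  ring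

theorem hasDerivAt_div_one_add {s : ℝ} (hs : 0 ≤ s) :
    HasDerivAt (fun s : ℝ => s / (1 + s)) ((1 + s)⁻¹ ^ 2) s := by
  have h : (1 : ℝ) + s ≠ 0 := by linarith
  refine ((hasDerivAt_id s).div ((hasDerivAt_id s).const_add 1) h).congr_deriv ?_
  simp only [id]
  field_simp
  ring

theorem hasDerivAt_flow_of_gaussMean {d N : ℕ} [NeZero N]
    {y : Fin N → EuclideanSpace ℝ (Fin d)} {z : ℝ → EuclideanSpace ℝ (Fin d)}
    (hz : ∀ s, HasDerivAt z (gaussMean y s (z s)) s) {t : ℝ} (ht : t < 1) :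
    HasDerivAt (fun t => (1 - t) • z (t / (1 - t)))
      (optimalVelocity y t ((1 - t) • z (t / (1 - t)))) t := by
  have h : (1 : ℝ) - t ≠ 0 := by linarith
  have h1 := ((hasDerivAt_id t).const_sub 1).fun_smul
    ((hz (t / (1 - t))).scomp t (hasDerivAt_div_one_sub ht))
  refine h1.congr_deriv ?_
  rw [optimalVelocity_eq, inv_smul_smul₀ h, smul_sub, inv_smul_smul₀ h, Function.comp_apply, id,
    smul_smul, neg_one_smul, ← sub_eq_add_neg]
  congr 2
  field_simp

theorem hasDerivWithinAt_gaussMean_of_flow {d N : ℕ} [NeZero N]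
    {y : Fin N → EuclideanSpace ℝ (Fin d)} {f : ℝ → EuclideanSpace ℝ (Fin d)}
    (hf : ∀ t ∈ Ico (0 : ℝ) 1, HasDerivWithinAt f (optimalVelocity y t (f t)) (Icc 0 1) t)
    {s : ℝ} (hs : 0 ≤ s) :
    HasDerivWithinAt (fun s => (1 + s) • f (s / (1 + s)))
      (gaussMean y s ((1 + s) • f (s / (1 + s)))) (Ici 0) s := by
  have h : (1 : ℝ) + s ≠ 0 := by linarith
  have hmem : s / (1 + s) ∈ Ico (0 : ℝ) 1 :=
    ⟨by positivity, by rw [div_lt_one (by linarith)]; linarith⟩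
  have hmaps : MapsTo (fun s : ℝ => s / (1 + s)) (Ici 0) (Icc 0 1) := fun r (hr : 0 ≤ r) =>
    ⟨by positivity, by rw [div_le_one (by linarith)]; linarith⟩
  have h1 := ((hasDerivAt_id s).const_add 1).hasDerivWithinAt.fun_smul
    ((hf _ hmem).scomp s (hasDerivAt_div_one_add hs).hasDerivWithinAt hmaps)
  refine h1.congr_deriv ?_
  have hsub : 1 - s / (1 + s) = (1 + s)⁻¹ := by field_simp; ring
  have hdiv : s / (1 + s) / (1 + s)⁻¹ = s := by field_simp
  rw [optimalVelocity_eq, hsub, hdiv, inv_inv, Function.comp_apply, id, one_smul, smul_smul,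
    smul_smul, show (1 + s) * (1 + s)⁻¹ ^ 2 * (1 + s) = 1 by field_simp, one_smul,
    sub_add_cancel]

theorem flow_eq_of_gaussMean {d N : ℕ} [NeZero N] {y : Fin N → EuclideanSpace ℝ (Fin d)}
    {f z : ℝ → EuclideanSpace ℝ (Fin d)}
    (hf : ∀ t ∈ Ico (0 : ℝ) 1, HasDerivWithinAt f (optimalVelocity y t (f t)) (Icc 0 1) t)
    (hz : ∀ s, HasDerivAt z (gaussMean y s (z s)) s) (h0 : f 0 = z 0) {t : ℝ}
    (ht : t ∈ Ico (0 : ℝ) 1) : f t = (1 - t) • z (t / (1 - t)) := by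
  have h : (1 : ℝ) - t ≠ 0 := by linarith [ht.2]
  have hs : 0 ≤ t / (1 - t) := div_nonneg ht.1 (by linarith [ht.2])
  have heq := ODE_solution_unique_of_contDiff_right (contDiff_gaussMean y)
    (a := 0) (b := t / (1 - t))
    (fun r hr => ((hasDerivWithinAt_gaussMean_of_flow hf hr.1).mono
      Icc_subset_Ici_self).continuousWithinAt)
    (fun r hr => (hasDerivWithinAt_gaussMean_of_flow hf hr.1).mono (Ici_subset_Ici.2 hr.1))
    (fun r _ => (hz r).continuousAt.continuousWithinAt) (fun r _ => (hz r).hasDerivWithinAt)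
    (by simpa using h0) (right_mem_Icc.2 hs)
  have h1 : 1 + t / (1 - t) = (1 - t)⁻¹ := by field_simp; ring
  have h2 : t / (1 - t) / (1 - t)⁻¹ = t := by field_simp
  simp only [h1, h2] at heq
  rw [← heq, smul_inv_smul₀ h]

/-- The endpoint of the flow is the limit of `s⁻¹ • z s`, since `(1 - t) • z s = t • s⁻¹ • z s` for
`s = t / (1 - t)`. -/
theorem tendsto_flow_of_tendsto {E : Type*} [NormedAddCommGroup E] [NormedSpace ℝ E] {z : ℝ → E}
    {p : E} (h : Tendsto (fun s => s⁻¹ • z s) atTop (𝓝 p)) :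
    Tendsto (fun t => (1 - t) • z (t / (1 - t))) (𝓝[Ico 0 1] 1) (𝓝 p) := by
  rw [nhdsWithin_Ico_eq_nhdsLT zero_lt_one]
  have hid : Tendsto (fun t : ℝ => t) (𝓝[<] 1) (𝓝 1) :=
    tendsto_nhdsWithin_of_tendsto_nhds tendsto_id
  have hsub : Tendsto (fun t : ℝ => 1 - t) (𝓝[<] 1) (𝓝[>] 0) := by
    refine tendsto_nhdsWithin_iff.2 ⟨by simpa using hid.const_sub 1, ?_⟩
    filter_upwards [self_mem_nhdsWithin] with t (ht : t < 1) using sub_pos.2 ht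
  have hdiv : Tendsto (fun t : ℝ => t / (1 - t)) (𝓝[<] 1) atTop :=
    hid.pos_mul_atTop one_pos (tendsto_inv_nhdsGT_zero.comp hsub)
  have hlim := hid.smul (h.comp hdiv)
  rw [one_smul] at hlim
  refine hlim.congr' ?_
  filter_upwards [Ioo_mem_nhdsLT zero_lt_one] with t ht
  have h1 : (1 : ℝ) - t ≠ 0 := by linarith [ht.2]
  have h2 := ht.1.ne'
  rw [Function.comp_apply, smul_smul]
  congr 1
  field_simp

theorem mainTheorem2 {d N : ℕ} (hN : 1 ≤ N) (y : Fin N → EuclideanSpace ℝ (Fin d)) :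
    ∃ φ : ℝ → EuclideanSpace ℝ (Fin d) → EuclideanSpace ℝ (Fin d),
      IsOptimalFlow y φ ∧
      (∀ ψ, IsOptimalFlow y ψ → ∀ t ∈ Set.Icc (0 : ℝ) 1, ∀ x, ψ t x = φ t x) ∧
      Set.range y ⊆ Set.range (fun x => φ 1 x) ∧
      (Set.range (fun x => φ 1 x) \ Set.range y).Finite := by
  have : NeZero N := ⟨by omega⟩
  choose Z hZ₀ hZ using fun x : EuclideanSpace ℝ (Fin d) =>
    exists_forall_hasDerivAt_of_bounded (contDiff_gaussMean y) (C := ∑ i, ‖y i‖₊)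
      (fun t x => by simpa using norm_gaussMean_le y t x) 0 x
  choose p hp hlim using fun x => exists_isCriticalPoint_tendsto (hZ x)
  obtain ⟨φ, hφlt, hφ1⟩ : ∃ φ : ℝ → EuclideanSpace ℝ (Fin d) → EuclideanSpace ℝ (Fin d),
      (∀ x, ∀ t < 1, φ t x = (1 - t) • Z x (t / (1 - t))) ∧ ∀ x, φ 1 x = p x :=
    ⟨fun t x => if t < 1 then (1 - t) • Z x (t / (1 - t)) else p x,
      fun _ _ ht => if_pos ht, fun _ => if_neg (lt_irrefl _)⟩
  have hder (x) {t : ℝ} (ht : t < 1) :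
      HasDerivAt (fun s => φ s x) (optimalVelocity y t (φ t x)) t := by
    rw [hφlt x t ht]
    refine (hasDerivAt_flow_of_gaussMean (hZ x) ht).congr_of_eventuallyEq ?_
    filter_upwards [Iio_mem_nhds ht] with s hs using hφlt x s hs
  have hflow : IsOptimalFlow y φ := by
    refine ⟨fun x => by simp [hφlt x 0 zero_lt_one, hZ₀], fun x t ht => ?_,
      fun x t ht => (hder x ht.2).hasDerivWithinAt⟩
    rcases ht.2.lt_or_eq with h | rfl
    · exact (hder x h).continuousAt.continuousWithinAt
    · rw [← Ico_insert_right zero_le_one, continuousWithinAt_insert_self, ContinuousWithinAt, hφ1]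
      refine (tendsto_flow_of_tendsto (hlim x)).congr' ?_
      filter_upwards [self_mem_nhdsWithin] with s hs using (hφlt x s hs.2).symm
  refine ⟨φ, hflow, fun ψ hψ t ht x => ?_, ?_, ?_⟩
  · have hIco : EqOn (fun t => ψ t x) (fun t => φ t x) (Ico 0 1) := fun t ht => by
      simp only [hφlt x t ht.2]
      exact flow_eq_of_gaussMean (hψ.hasDeriv x) (hZ x) (by rw [hψ.initial, hZ₀]) ht
    exact hIco.of_subset_closure (hψ.continuousOn x) (hflow.continuousOn x) Ico_subset_Icc_self
      (closure_Ico (zero_ne_one (α := ℝ))).ge ht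
  · rintro _ ⟨i, rfl⟩
    obtain ⟨z, hz, hzlim⟩ := exists_forall_hasDerivAt_tendsto y i
    refine ⟨z 0, (hφ1 _).trans (tendsto_nhds_unique (hlim (z 0)) (hzlim.congr' ?_))⟩
    filter_upwards [eventually_ge_atTop 0] with s hs
    rw [ODE_solution_unique_of_contDiff_right (contDiff_gaussMean y) (a := 0) (b := s)
      (fun r _ => (hz r).continuousAt.continuousWithinAt) (fun r _ => (hz r).hasDerivWithinAt)
      (fun r _ => (hZ (z 0) r).continuousAt.continuousWithinAt)
      (fun r _ => (hZ (z 0) r).hasDerivWithinAt) (hZ₀ _).symm (right_mem_Icc.2 hs)]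
  · refine finite_of_forall_isCriticalPoint (y := y) ?_
    rintro _ ⟨⟨x, rfl⟩, -⟩
    simpa only [hφ1] using hp x
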